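/- Let $n\ge 2$. A real matrix is totally nonnegative (TN) if all its minors are nonnegative and totally positive (TP) if all its minors are positive. A matrix $A\in\mathbb{R}^{n\times n}$ is oscillatory if it is TN and $A^k$ is TP for some positive integer $k$; its exponent $r(A)$ is the least positive integer $k$ such that $A^k$ is TP. For $i\in\{2,\dots,n\}$ and $q\in\mathbb{R}$ let $L_i(q)=I+qE_{i,i-1}$, where $E_{i,i-1}$ is the $n\times n$ matrix whose only nonzero entry is a one in position $(i,i-1)$. For real numbers $v_i,\dots,v_n$ (the multipliers) let $W_i(v)=L_n(v_n)L_{n-1}(v_{n-1})\cdots L_i(v_i)$. For $s\in\{2,\dots,n\}$ let $Z_1(s)$ be the set of all products $W_2(\ell^2)W_3(\ell^3)\cdots W_s(\ell^s)$ with all multipliers positive. For $i\in\{2,\dots,n-1\}$ let $\Psi_i$ be the set of all $W_i(v)$ with $v_i>0$, $v_{i+1},\dots,v_n\ge 0$ and $v_{i+1}v_{i+2}\cdots v_n=0$. Let $Z_2(2)$ be the set of all products $W_2(\ell^2)\cdots W_n(\ell^n)$ with all multipliers positive, and for $s\in\{3,\dots,n\}$ let $Z_2(s)$ be the set of all products $L_2(a_2)L_3(a_3)\cdots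 L_{s-2}(a_{s-2})\,P\,W_s(\ell^s)W_{s+1}(\ell^{s+1})\cdots W_n(\ell^n)$ with $P\in\Psi_{s-1}$ and all $a_k$ and all multipliers in $\ell^s,\dots,\ell^n$ positive (the product of the $L_k(a_k)$ is empty if $s=3$). Put $\mu_1(s)=\left\lceil\frac{n-1}{s-1}\right\rceil$ and $\mu_2(s)=s-1$. (a) Let $A\in\mathbb{R}^{n\times n}$ be oscillatory, and suppose that $A=LDU$ with $L\in Z_i(s_i)$, $D$ a diagonal matrix with positive diagonal entries, and $U^T\in Z_j(s_j)$, where $i,j\in\{1,2\}$ and $s_i,s_j\in\{2,\dots,n\}$ (if $i=j$, the two parameters may still differ). Then $$r(A)=\max\{\mu_i(s_i),\mu_j(s_j)\}.$$ (b) The values $\max\{\mu_i(s),\mu_j(t)\}$, over all $i,j\in\{1,2\}$ and $s,t\in\{2,\dots,n\}$, form exactly the set $\{1,\dots,n-1\}$, and the exponents of the oscillatory matrices $A$ as in (a) form exactly the set $\{1,\dots,n-1\}$. -/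

import Mathlib

namespace OscExp

/-- `A` is totally nonnegative: every minor (with increasing row and column indices) is `≥ 0`. -/
def IsTN {n m : ℕ} (A : Matrix (Fin n) (Fin m) ℝ) : Prop :=
  ∀ (k : ℕ) (f : Fin k ↪o Fin n) (g : Fin k ↪o Fin m), 0 ≤ (A.submatrix f g).det

/-- `A` is totally positive: every minor (with increasing row and column indices) is `> 0`.
(The empty minor, `k = 0`, equals one.) -/
def IsTP {n m : ℕ} (A : Matrix (Fin n) (Fin m) ℝ) : Prop :=
  ∀ (k : ℕ) (f : Fin k ↪o Fin n) (g : Fin k ↪o Fin m), 0 < (A.submatrix f g).det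

/-- `A` is oscillatory: it is totally nonnegative and some positive power is totally positive. -/
def IsOscillatory {n : ℕ} (A : Matrix (Fin n) (Fin n) ℝ) : Prop :=
  IsTN A ∧ ∃ k : ℕ, 0 < k ∧ IsTP (A ^ k)

/-- The exponent `r(A)`: the least positive `k` such that `A ^ k` is totally positive.
The set is nonempty whenever `A` is oscillatory. -/
noncomputable def exponent {n : ℕ} (A : Matrix (Fin n) (Fin n) ℝ) : ℕ :=
  sInf {k : ℕ | 0 < k ∧ IsTP (A ^ k)}

/-- The elementary bidiagonal matrix `L_i(q) = I + q E_{i,i-1}`, where `2 ≤ i ≤ n` and the rows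
and columns are numbered from one (so `a : Fin n` is row number `a + 1`). -/
noncomputable def elemL (n i : ℕ) (q : ℝ) : Matrix (Fin n) (Fin n) ℝ :=
  1 + Matrix.of fun a b : Fin n => if (a : ℕ) + 1 = i ∧ (b : ℕ) + 2 = i then q else 0

/-- `W_i = L_n(v n) L_{n-1}(v (n-1)) ⋯ L_i(v i)`; the multiplier of `L_j` is called `v j`. -/
noncomputable def W (n i : ℕ) (v : ℕ → ℝ) : Matrix (Fin n) (Fin n) ℝ :=
  ((List.range (n + 1 - i)).map fun t => elemL n (n - t) (v (n - t))).prod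

/-- `W_a(ℓ a) W_{a+1}(ℓ (a+1)) ⋯ W_b(ℓ b)`; the multiplier of `L_j` in `W_i` is `ℓ i j`. -/
noncomputable def Wprod (n a b : ℕ) (l : ℕ → ℕ → ℝ) : Matrix (Fin n) (Fin n) ℝ :=
  ((List.range' a (b + 1 - a)).map fun i => W n i (l i)).prod

/-- `L_2(v 2) L_3(v 3) ⋯ L_b(v b)`, the identity if `b < 2`. -/
noncomputable def Lprod (n b : ℕ) (v : ℕ → ℝ) : Matrix (Fin n) (Fin n) ℝ :=
  ((List.range' 2 (b + 1 - 2)).map fun i => elemL n i (v i)).prod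

/-- `Z_1(s)`: the matrices `W_2 ⋯ W_s` with all multipliers positive. -/
def Z1 (n s : ℕ) : Set (Matrix (Fin n) (Fin n) ℝ) :=
  {M | ∃ l : ℕ → ℕ → ℝ, (∀ i j, 2 ≤ i → i ≤ s → i ≤ j → j ≤ n → 0 < l i j) ∧
    M = Wprod n 2 s l}

/-- `Ψ_i`: the matrices `W_i` with nonnegative multipliers, where the multiplier of `L_i` is
positive and at least one of the multipliers of `L_{i+1}, …, L_n` is zero. -/
def Psi (n i : ℕ) : Set (Matrix (Fin n) (Fin n) ℝ) :=
  {M | ∃ v : ℕ → ℝ, (∀ j, i ≤ j → j ≤ n → 0 ≤ v j) ∧ 0 < v i ∧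
    ∏ j ∈ Finset.Icc (i + 1) n, v j = 0 ∧ M = W n i v}

/-- `Z_2(s)`: the matrices `L_2 ⋯ L_{s-2} P W_s ⋯ W_n` with `P ∈ Ψ_{s-1}` and all other
multipliers positive if `s ≥ 3`, and the matrices `W_2 ⋯ W_n` with all multipliers positive
if `s = 2`. -/
def Z2 (n s : ℕ) : Set (Matrix (Fin n) (Fin n) ℝ) :=
  {M | ∃ l : ℕ → ℕ → ℝ, (∀ i j, s ≤ i → i ≤ n → i ≤ j → j ≤ n → 0 < l i j) ∧
    ((s = 2 ∧ M = Wprod n 2 n l) ∨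
      (3 ≤ s ∧ ∃ v : ℕ → ℝ, (∀ i, 2 ≤ i → i ≤ s - 2 → 0 < v i) ∧
        ∃ P ∈ Psi n (s - 1), M = Lprod n (s - 2) v * P * Wprod n s n l))}

/-- The index set `{1, 2}` of the two families of classes. -/
inductive ClassIndex : Type
  | one : ClassIndex
  | two : ClassIndex

/-- `Z_i(s)`, for `i ∈ {1, 2}`. -/
def Z (n : ℕ) : ClassIndex → ℕ → Set (Matrix (Fin n) (Fin n) ℝ)
  | ClassIndex.one, s => Z1 n s
  | ClassIndex.two, s => Z2 n s

/-- `μ_1(s) = ⌈(n - 1) / (s - 1)⌉` and `μ_2(s) = s - 1`; used for `2 ≤ s ≤ n` only. -/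
def mu (n : ℕ) : ClassIndex → ℕ → ℕ
  | ClassIndex.one, s => ⌈((n : ℚ) - 1) / ((s : ℚ) - 1)⌉₊
  | ClassIndex.two, s => s - 1

/-- `A = L D U` with `L ∈ Z_i(s)`, `D` a diagonal matrix with positive diagonal entries, and
`Uᵀ ∈ Z_j(t)`, where the parameters `s` and `t` lie in `{2, …, n}`. -/
def IsZFactorizable {n : ℕ} (A : Matrix (Fin n) (Fin n) ℝ) (i : ClassIndex) (s : ℕ)
    (j : ClassIndex) (t : ℕ) : Prop :=
  s ∈ Set.Icc 2 n ∧ t ∈ Set.Icc 2 n ∧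
    ∃ (L U : Matrix (Fin n) (Fin n) ℝ) (d : Fin n → ℝ),
      L ∈ Z n i s ∧ (∀ k, 0 < d k) ∧ U.transpose ∈ Z n j t ∧ A = L * Matrix.diagonal d * U

end OscExp

namespace OscExp

open Matrix

/-! Each factor in `Z_i(s)` is a product of elementary bidiagonal matrices with positive
multipliers, and whether a power of `A` is totally positive depends only on the words of indices of
these products, not on the multipliers.

Reduction to words. A product (upper elementary) * (lower elementary) can be rewritten as (lower) *
(positive diagonal) * (upper) with the same indices and new positive multipliers
(`exists_elemL_transpose_mul`). Hence, if `L` has word `w` and `Uᵀ` has word `w'`, then `(L D U) ^ m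
= L' D' U'`, where `L'` has word `w` repeated `m` times and `U'ᵀ` has word `w'` repeated `m` times
(`exists_pow_factorization`).

Upper bound. On a totally nonnegative matrix, an elementary left factor never decreases a minor, and
the letter `i` adds a positive multiple of the minor in which row `i` is replaced by row `i - 1`. So
if both repeated words can carry every row set down to an initial segment, every minor of `L' D' U'`
is positive (`isTP_of_sweeps`). For `Z_1(s)`, `m` repetitions contain the full word of `W_2 ⋯ W_n`
once `m (s - 1) ≥ n - 1`. For `Z_2(s)`, `s ≥ 3`, one repetition pushes the `p`-th smallest row (`p`
from zero) to at most `s - 2 + p` (rows also from zero), and each further one lowers this bound by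
one.

Lower bound. For `Z_2(s)`, `s ≥ 3`, the zero multiplier in `Ψ_{s-1}` keeps the entry `(n, 1)` of
`L'` equal to zero for fewer than `s - 1` repetitions. For `Z_1(s)`, each factor `W_i` enlarges the
support of a preimage of the first unit vector by at most one coordinate, so with too few factors
the minor with rows `2, …, n` and columns `1, …, n - 1` vanishes.

Both bounds apply to `L` and, by transposition, to `U`, whence the maximum. All values `1, …, n - 1`
are already attained by `μ_2`. -/

/-! ### Words of elementary factors and the words of the given products. -/

/-- `M` is a product of elementary matrices along the word `w`, with positive multipliers. -/
inductive HasWord (n : ℕ) : List ℕ → Matrix (Fin n) (Fin n) ℝ → Prop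
  | nil : HasWord n [] 1
  | cons {w M} (i : ℕ) (q : ℝ) (hq : 0 < q) (h : HasWord n w M) :
      HasWord n (i :: w) (elemL n i q * M)

theorem HasWord.append {n : ℕ} {w w' : List ℕ} {M M' : Matrix (Fin n) (Fin n) ℝ}
    (h : HasWord n w M) (h' : HasWord n w' M') : HasWord n (w ++ w') (M * M') := by
  induction h with
  | nil => simpa using h'
  | cons i q hq _ ih => rw [Matrix.mul_assoc]; exact .cons i q hq ih

theorem elemL_zero (n i : ℕ) : elemL n i 0 = 1 := by
  ext a b; simp [elemL]

theorem hasWord_prod (n : ℕ) (v : ℕ → ℝ) (l : List ℕ) (h : ∀ i ∈ l, 0 < v i) :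
    HasWord n l (l.map fun i => elemL n i (v i)).prod := by
  induction l with
  | nil => exact .nil
  | cons a l ih =>
    simp only [List.map_cons, List.prod_cons]
    exact .cons a _ (h a (by simp)) (ih fun i hi => h i (by simp [hi]))

theorem hasWord_prod_filter (n : ℕ) (v : ℕ → ℝ) (l : List ℕ) (h : ∀ i ∈ l, 0 ≤ v i) :
    HasWord n (l.filter fun i => 0 < v i) (l.map fun i => elemL n i (v i)).prod := by
  induction l with
  | nil => exact .nil
  | cons a l ih =>
    have ih := ih fun i hi => h i (by simp [hi])
    simp only [List.map_cons, List.prod_cons]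
    by_cases ha : 0 < v a
    · rw [List.filter_cons_of_pos (by simpa using ha)]
      exact .cons a _ ha ih
    · rw [List.filter_cons_of_neg (by simpa using ha)]
      have : v a = 0 := le_antisymm (not_lt.1 ha) (h a (by simp))
      simpa [this, elemL_zero] using ih

/-- The decreasing word `n, n-1, …, i`. -/
def descWord (n i : ℕ) : List ℕ := (List.range (n + 1 - i)).map fun t => n - t

theorem mem_descWord {n i j : ℕ} (hi : 1 ≤ i) : j ∈ descWord n i ↔ i ≤ j ∧ j ≤ n := by
  simp only [descWord, List.mem_map, List.mem_range]
  constructor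
  · rintro ⟨t, ht, rfl⟩; omega
  · rintro ⟨h1, h2⟩; exact ⟨n - j, by omega, by omega⟩

theorem W_eq (n i : ℕ) (v : ℕ → ℝ) :
    W n i v = ((descWord n i).map fun j => elemL n j (v j)).prod := by
  simp [W, descWord, Function.comp_def]

theorem hasWord_W {n i : ℕ} (hi : 1 ≤ i) {v : ℕ → ℝ} (h : ∀ j, i ≤ j → j ≤ n → 0 < v j) :
    HasWord n (descWord n i) (W n i v) := by
  rw [W_eq]
  exact hasWord_prod _ _ _ fun j hj => by
    rw [mem_descWord hi] at hj; exact h j hj.1 hj.2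

theorem hasWord_Wprod {n a b : ℕ} (ha : 1 ≤ a) {l : ℕ → ℕ → ℝ}
    (h : ∀ i j, a ≤ i → i ≤ b → i ≤ j → j ≤ n → 0 < l i j) :
    HasWord n ((List.range' a (b + 1 - a)).flatMap (descWord n)) (Wprod n a b l) := by
  unfold Wprod
  have key : ∀ L : List ℕ, (∀ i ∈ L, a ≤ i ∧ i ≤ b) →
      HasWord n (L.flatMap (descWord n)) (L.map fun i => W n i (l i)).prod := by
    intro L
    induction L with
    | nil => intro _; exact .nil
    | cons i L ih =>
      intro hL
      simp only [List.flatMap_cons, List.map_cons, List.prod_cons]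
      have hi := hL i (by simp)
      exact (hasWord_W (by omega) fun j h1 h2 => h i j hi.1 hi.2 h1 h2).append
        (ih fun i hi => hL i (by simp [hi]))
  refine key _ fun i hi => ?_
  rw [List.mem_range'_1] at hi
  omega

theorem hasWord_Lprod {n b : ℕ} {v : ℕ → ℝ} (h : ∀ i, 2 ≤ i → i ≤ b → 0 < v i) :
    HasWord n (List.range' 2 (b + 1 - 2)) (Lprod n b v) :=
  hasWord_prod _ _ _ fun i hi => by
    rw [List.mem_range'_1] at hi
    exact h i (by omega) (by omega)

/-! ### Interchanging lower, diagonal and upper factors; factorization of powers. -/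

theorem elemL_eq_one_of_not {n i : ℕ} (h : ¬ (2 ≤ i ∧ i ≤ n)) (q : ℝ) : elemL n i q = 1 := by
  ext a b
  have : ¬ ((a : ℕ) + 1 = i ∧ (b : ℕ) + 2 = i) := by omega
  simp [elemL, this]

theorem elemL_eq_single {n i : ℕ} (r p : Fin n) (hr : (r : ℕ) + 1 = i) (hp : (p : ℕ) + 2 = i)
    (q : ℝ) : elemL n i q = 1 + single r p q := by
  ext a b
  have : ((a : ℕ) + 1 = i ∧ (b : ℕ) + 2 = i) ↔ (r = a ∧ p = b) := by
    simp only [Fin.ext_iff]; omega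
  simp [elemL, single_apply, this]

theorem exists_elemL_diagonal {n : ℕ} (i : ℕ) {q : ℝ} (hq : 0 < q) {d : Fin n → ℝ}
    (hd : ∀ k, 0 < d k) :
    ∃ q', 0 < q' ∧ diagonal d * elemL n i q = elemL n i q' * diagonal d := by
  by_cases h : 2 ≤ i ∧ i ≤ n
  · obtain ⟨h2, hn⟩ := h
    let r : Fin n := ⟨i - 1, by omega⟩
    let p : Fin n := ⟨i - 2, by omega⟩
    refine ⟨d r * q / d p, by have := hd r; have := hd p; positivity, ?_⟩
    have hr : (r : ℕ) + 1 = i := by simp [r]; omega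
    have hp : (p : ℕ) + 2 = i := by simp [p]; omega
    rw [elemL_eq_single r p hr hp, elemL_eq_single r p hr hp, mul_add, add_mul, mul_one, one_mul]
    congr 1
    ext a b
    have := (hd p).ne'
    simp only [diagonal_mul, mul_diagonal, single_apply]
    split_ifs with hab
    · obtain ⟨rfl, rfl⟩ := hab
      field_simp
    · simp
  · exact ⟨1, one_pos, by simp [elemL_eq_one_of_not h]⟩

theorem HasWord.diagonal_mul {n : ℕ} {w : List ℕ} {M : Matrix (Fin n) (Fin n) ℝ}
    (h : HasWord n w M) {d : Fin n → ℝ} (hd : ∀ k, 0 < d k) :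
    ∃ M', HasWord n w M' ∧ diagonal d * M = M' * diagonal d := by
  induction h with
  | nil => exact ⟨1, .nil, by simp⟩
  | @cons w M i q hq _ ih =>
    obtain ⟨M', h', e⟩ := ih
    obtain ⟨q', hq', e'⟩ := exists_elemL_diagonal i hq hd
    exact ⟨_, .cons i q' hq' h', by
      rw [← Matrix.mul_assoc, e', Matrix.mul_assoc, e, Matrix.mul_assoc]⟩

theorem HasWord.mul_diagonal_transpose {n : ℕ} {w : List ℕ} {U : Matrix (Fin n) (Fin n) ℝ}
    (h : HasWord n w Uᵀ) {d : Fin n → ℝ} (hd : ∀ k, 0 < d k) :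
    ∃ U', HasWord n w U'ᵀ ∧ U * diagonal d = diagonal d * U' := by
  obtain ⟨M', h', e⟩ := h.diagonal_mul hd
  refine ⟨M'ᵀ, by simpa using h', ?_⟩
  simpa using congrArg transpose e

/-- For `i ≠ j` the two factors commute, since both products of their off-diagonal units vanish; for
`i = j` this is the LDU factorization of the 2 × 2 matrix with rows `(1 + ab, a)` and `(b, 1)`. -/
theorem exists_elemL_transpose_mul {n : ℕ} (i j : ℕ) {a b : ℝ} (ha : 0 < a) (hb : 0 < b) :
    ∃ (a' b' : ℝ) (d : Fin n → ℝ), 0 < a' ∧ 0 < b' ∧ (∀ k, 0 < d k) ∧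
      (elemL n i a)ᵀ * elemL n j b = elemL n j b' * diagonal d * (elemL n i a')ᵀ := by
  by_cases hi : 2 ≤ i ∧ i ≤ n
  swap
  · exact ⟨1, b, 1, one_pos, hb, fun _ => one_pos, by simp [elemL_eq_one_of_not hi]⟩
  by_cases hj : 2 ≤ j ∧ j ≤ n
  swap
  · exact ⟨a, 1, 1, ha, one_pos, fun _ => one_pos, by simp [elemL_eq_one_of_not hj]⟩
  obtain ⟨hi2, hin⟩ := hi
  obtain ⟨hj2, hjn⟩ := hj
  let r : Fin n := ⟨i - 1, by omega⟩
  let p : Fin n := ⟨i - 2, by omega⟩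
  have hr : (r : ℕ) + 1 = i := by simp [r]; omega
  have hp : (p : ℕ) + 2 = i := by simp [p]; omega
  have hrp : r ≠ p := by simp [Fin.ext_iff]; omega
  by_cases hij : i = j
  · subst hij
    have hc : 0 < 1 + a * b := by positivity
    refine ⟨a / (1 + a * b), b / (1 + a * b),
      fun k => if k = p then 1 + a * b else if k = r then 1 / (1 + a * b) else 1,
      by positivity, by positivity, fun k => by dsimp only; split_ifs <;> positivity, ?_⟩
    have hD : diagonal (fun k => if k = p then 1 + a * b else if k = r then 1 / (1 + a * b) else 1)
        = 1 + single p p (a * b) + single r r (1 / (1 + a * b) - 1) := by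
      ext x y
      simp only [diagonal_apply, Matrix.add_apply, one_apply, single_apply]
      by_cases hxy : x = y
      · subst hxy
        by_cases h1 : x = p
        · subst h1; simp [hrp]
        · by_cases h2 : x = r
          · subst h2; simp [h1, Ne.symm h1]
          · simp [h1, h2, Ne.symm h1, Ne.symm h2]
      · have h1 : ¬ (p = x ∧ p = y) := fun h => hxy (h.1.symm.trans h.2)
        have h2 : ¬ (r = x ∧ r = y) := fun h => hxy (h.1.symm.trans h.2)
        simp [hxy, h1, h2]
    rw [hD]
    simp only [elemL_eq_single r p hr hp, transpose_add, transpose_one, transpose_single, mul_add,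
      add_mul, mul_one, one_mul, single_mul_single_same, single_mul_single_of_ne _ _ _ _ hrp,
      single_mul_single_of_ne _ _ _ _ hrp.symm, add_zero]
    ext x y
    simp only [Matrix.add_apply, one_apply, single_apply]
    have hrp' := hrp.symm
    by_cases x1 : r = x
    · subst x1
      by_cases y1 : r = y
      · subst y1; simp [hrp']; field_simp
      · by_cases y2 : p = y
        · subst y2; simp [hrp, hrp']; field_simp
        · simp [y1, y2]
    · by_cases x2 : p = x
      · subst x2
        by_cases y1 : r = y
        · subst y1; simp [hrp, hrp']; field_simp
        · by_cases y2 : p = y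
          · subst y2; simp [hrp]
          · simp [y1, y2]
      · simp [x1, x2]
  · let r' : Fin n := ⟨j - 1, by omega⟩
    let p' : Fin n := ⟨j - 2, by omega⟩
    have hr' : (r' : ℕ) + 1 = j := by simp [r']; omega
    have hp' : (p' : ℕ) + 2 = j := by simp [p']; omega
    have h1 : r ≠ r' := by simp [Fin.ext_iff]; omega
    have h2 : p' ≠ p := by simp [Fin.ext_iff]; omega
    refine ⟨a, b, 1, ha, hb, fun _ => one_pos, ?_⟩
    rw [show diagonal (1 : Fin n → ℝ) = 1 from diagonal_one]
    simp only [elemL_eq_single r p hr hp, elemL_eq_single r' p' hr' hp', transpose_add,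
      transpose_one, transpose_single, mul_add,
      add_mul, mul_one, one_mul, single_mul_single_of_ne _ _ _ _ h1,
      single_mul_single_of_ne _ _ _ _ h2]
    abel

theorem diagonal_mul_diagonal_pos {n : ℕ} {d e : Fin n → ℝ} (hd : ∀ k, 0 < d k)
    (he : ∀ k, 0 < e k) : ∃ c : Fin n → ℝ, (∀ k, 0 < c k) ∧
      diagonal d * diagonal e = diagonal c :=
  ⟨fun k => d k * e k, fun k => mul_pos (hd k) (he k), diagonal_mul_diagonal d e⟩

theorem HasWord.elemL_transpose_mul {n : ℕ} {w : List ℕ} {L : Matrix (Fin n) (Fin n) ℝ}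
    (h : HasWord n w L) (i : ℕ) {a : ℝ} (ha : 0 < a) :
    ∃ (L' : Matrix (Fin n) (Fin n) ℝ) (d : Fin n → ℝ) (a' : ℝ), HasWord n w L' ∧
      (∀ k, 0 < d k) ∧ 0 < a' ∧
      (elemL n i a)ᵀ * L = L' * diagonal d * (elemL n i a')ᵀ := by
  induction h generalizing a with
  | nil => exact ⟨1, 1, a, .nil, fun _ => one_pos, ha, by simp⟩
  | @cons w M j q hq _ ih =>
    obtain ⟨a', b', d, ha', hb', hd, e1⟩ := exists_elemL_transpose_mul (n := n) i j ha hq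
    obtain ⟨L', d', a'', hL', hd', ha'', e2⟩ := ih ha'
    obtain ⟨L'', hL'', e3⟩ := hL'.diagonal_mul hd
    obtain ⟨c, hc, e4⟩ := diagonal_mul_diagonal_pos hd hd'
    refine ⟨_, c, a'', .cons j b' hb' hL'', hc, ha'', ?_⟩
    calc (elemL n i a)ᵀ * (elemL n j q * M)
        = (elemL n i a)ᵀ * elemL n j q * M := by rw [Matrix.mul_assoc]
      _ = elemL n j b' * diagonal d * ((elemL n i a')ᵀ * M) := by rw [e1, Matrix.mul_assoc]
      _ = elemL n j b' * (diagonal d * L') * diagonal d' * (elemL n i a'')ᵀ := by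
          rw [e2]; simp only [Matrix.mul_assoc]
      _ = elemL n j b' * L'' * (diagonal d * diagonal d') * (elemL n i a'')ᵀ := by
          rw [e3]; simp only [Matrix.mul_assoc]
      _ = _ := by rw [e4]

theorem HasWord.transpose_mul {n : ℕ} {w w' : List ℕ} {L V : Matrix (Fin n) (Fin n) ℝ}
    (hV : HasWord n w' V) (hL : HasWord n w L) :
    ∃ (L' V' : Matrix (Fin n) (Fin n) ℝ) (d : Fin n → ℝ), HasWord n w L' ∧ HasWord n w' V' ∧
      (∀ k, 0 < d k) ∧ Vᵀ * L = L' * diagonal d * V'ᵀ := by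
  induction hV generalizing L with
  | nil => exact ⟨L, 1, 1, hL, .nil, fun _ => one_pos, by simp⟩
  | @cons w' M i q hq _ ih =>
    obtain ⟨L1, d1, a', hL1, hd1, ha', e1⟩ := hL.elemL_transpose_mul i hq
    obtain ⟨L2, V2, d2, hL2, hV2, hd2, e2⟩ := ih hL1
    obtain ⟨U3, hU3, e3⟩ := HasWord.mul_diagonal_transpose (U := V2ᵀ) (by simpa using hV2) hd1
    obtain ⟨c, hc, e4⟩ := diagonal_mul_diagonal_pos hd2 hd1
    refine ⟨L2, elemL n i a' * U3ᵀ, c, hL2, .cons i a' ha' hU3, hc, ?_⟩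
    calc (elemL n i q * M)ᵀ * L = Mᵀ * ((elemL n i q)ᵀ * L) := by
          rw [Matrix.transpose_mul, Matrix.mul_assoc]
      _ = Mᵀ * L1 * diagonal d1 * (elemL n i a')ᵀ := by rw [e1]; simp only [Matrix.mul_assoc]
      _ = L2 * diagonal d2 * (V2ᵀ * diagonal d1) * (elemL n i a')ᵀ := by
          rw [e2]; simp only [Matrix.mul_assoc]
      _ = L2 * (diagonal d2 * diagonal d1) * (U3 * (elemL n i a')ᵀ) := by
          rw [e3]; simp only [Matrix.mul_assoc]
      _ = _ := by rw [e4, Matrix.transpose_mul, transpose_transpose]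

/-- The `m`-fold repetition of a word. -/
def wordPow (w : List ℕ) (m : ℕ) : List ℕ := (List.replicate m w).flatten

theorem wordPow_succ (w : List ℕ) (m : ℕ) : wordPow w (m + 1) = w ++ wordPow w m := by
  simp [wordPow, List.replicate_succ]

theorem wordPow_succ' (w : List ℕ) (m : ℕ) : wordPow w (m + 1) = wordPow w m ++ w := by
  simp [wordPow, List.replicate_succ']

theorem wordPow_sublist (w : List ℕ) {m k : ℕ} (h : m ≤ k) :
    List.Sublist (wordPow w m) (wordPow w k) := by
  induction k, h using Nat.le_induction with
  | base => exact List.Sublist.refl _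
  | succ k _ ih =>
    rw [wordPow_succ]
    exact ih.trans (List.sublist_append_right _ _)

/-- In `A ^ (m + 1) = L D (Vᵀ L₁) E V₁ᵀ` the middle product is reordered by `HasWord.transpose_mul`,
and the diagonal factors are then gathered in the centre; no step alters a word. -/
theorem exists_pow_factorization {n : ℕ} {w w' : List ℕ} {L V : Matrix (Fin n) (Fin n) ℝ}
    (hL : HasWord n w L) (hV : HasWord n w' V) {d : Fin n → ℝ} (hd : ∀ k, 0 < d k) (m : ℕ) :
    ∃ (L' V' : Matrix (Fin n) (Fin n) ℝ) (e : Fin n → ℝ), HasWord n (wordPow w m) L' ∧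
      HasWord n (wordPow w' m) V' ∧ (∀ k, 0 < e k) ∧
      (L * diagonal d * Vᵀ) ^ m = L' * diagonal e * V'ᵀ := by
  induction m with
  | zero => exact ⟨1, 1, 1, .nil, .nil, fun _ => one_pos, by simp⟩
  | succ m ih =>
    obtain ⟨L1, V1, e, hL1, hV1, he, h1⟩ := ih
    obtain ⟨L2, V2, d2, hL2, hV2, hd2, h2⟩ := hV.transpose_mul hL1
    obtain ⟨L3, hL3, h3⟩ := hL2.diagonal_mul hd
    obtain ⟨U4, hU4, h4⟩ := HasWord.mul_diagonal_transpose (U := V2ᵀ) (by simpa using hV2) he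
    obtain ⟨c, hc, h5⟩ := diagonal_mul_diagonal_pos hd hd2
    obtain ⟨c', hc', h6⟩ := diagonal_mul_diagonal_pos hc he
    refine ⟨L * L3, V1 * U4ᵀ, c', ?_, ?_, hc', ?_⟩
    · rw [wordPow_succ]; exact hL.append hL3
    · rw [wordPow_succ']; exact hV1.append hU4
    calc (L * diagonal d * Vᵀ) ^ (m + 1)
        = L * diagonal d * (Vᵀ * L1) * diagonal e * V1ᵀ := by
          rw [pow_succ', h1]; simp only [Matrix.mul_assoc]
      _ = L * (diagonal d * L2) * diagonal d2 * (V2ᵀ * diagonal e) * V1ᵀ := by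
          rw [h2]; simp only [Matrix.mul_assoc]
      _ = L * L3 * (diagonal d * diagonal d2 * diagonal e) * (U4 * V1ᵀ) := by
          rw [h3, h4]; simp only [Matrix.mul_assoc]
      _ = _ := by rw [h5, h6, Matrix.transpose_mul, transpose_transpose]

/-! ### Minors and total nonnegativity under elementary factors. -/

theorem elemL_mul_apply_of_ne {n i : ℕ} {q : ℝ} (M : Matrix (Fin n) (Fin n) ℝ) {a : Fin n}
    (h : ¬ ((a : ℕ) + 1 = i ∧ 2 ≤ i)) (b : Fin n) : (elemL n i q * M) a b = M a b := by
  rw [elemL, add_mul, one_mul, Matrix.add_apply, mul_apply, Finset.sum_eq_zero, add_zero]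
  intro c _
  rw [of_apply, if_neg, zero_mul]
  omega

theorem elemL_mul_apply {n i : ℕ} {q : ℝ} (M : Matrix (Fin n) (Fin n) ℝ) {a r : Fin n}
    (ha : (a : ℕ) + 1 = i) (hr : (r : ℕ) + 2 = i) (b : Fin n) :
    (elemL n i q * M) a b = M a b + q * M r b := by
  rw [elemL_eq_single a r ha hr, add_mul, one_mul, Matrix.add_apply]
  simp

theorem det_submatrix_elemL_mul {n k i : ℕ} {q : ℝ} (M : Matrix (Fin n) (Fin n) ℝ)
    {f f' : Fin k → Fin n} (g : Fin k → Fin n) (hf : Function.Injective f) {p : Fin k}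
    (hp : (f p : ℕ) + 1 = i) (hp' : (f' p : ℕ) + 2 = i) (hf' : ∀ r, r ≠ p → f' r = f r) :
    ((elemL n i q * M).submatrix f g).det
      = (M.submatrix f g).det + q * (M.submatrix f' g).det := by
  have h1 : (elemL n i q * M).submatrix f g
      = (M.submatrix f g).updateRow p (M.submatrix f g p + q • fun c => M (f' p) (g c)) := by
    ext a b
    by_cases hap : a = p
    · subst hap
      simp [elemL_mul_apply M hp hp']
    · rw [updateRow_ne hap, submatrix_apply, submatrix_apply, elemL_mul_apply_of_ne]
      rintro ⟨h, -⟩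
      exact hap (hf (Fin.ext (by omega)))
  have h2 : M.submatrix f' g = (M.submatrix f g).updateRow p (fun c => M (f' p) (g c)) := by
    ext a b
    by_cases hap : a = p
    · subst hap; simp
    · rw [updateRow_ne hap, submatrix_apply, submatrix_apply, hf' a hap]
  rw [h1, h2, det_updateRow_add, det_updateRow_smul, updateRow_eq_self]

theorem isTN_iff {n m : ℕ} {A : Matrix (Fin n) (Fin m) ℝ} :
    IsTN A ↔ ∀ (k : ℕ) (f : Fin k → Fin n) (g : Fin k → Fin m), StrictMono f → StrictMono g →
      0 ≤ (A.submatrix f g).det :=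
  ⟨fun h k f g hf hg => h k (OrderEmbedding.ofStrictMono f hf) (OrderEmbedding.ofStrictMono g hg),
    fun h k f g => h k f g f.strictMono g.strictMono⟩

theorem isTP_iff {n m : ℕ} {A : Matrix (Fin n) (Fin m) ℝ} :
    IsTP A ↔ ∀ (k : ℕ) (f : Fin k → Fin n) (g : Fin k → Fin m), StrictMono f → StrictMono g →
      0 < (A.submatrix f g).det :=
  ⟨fun h k f g hf hg => h k (OrderEmbedding.ofStrictMono f hf) (OrderEmbedding.ofStrictMono g hg),
    fun h k f g => h k f g f.strictMono g.strictMono⟩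

theorem IsTN.transpose {n m : ℕ} {A : Matrix (Fin n) (Fin m) ℝ} (h : IsTN A) : IsTN Aᵀ :=
  fun k f g => by rw [← transpose_submatrix, det_transpose]; exact h k g f

theorem IsTP.transpose {n m : ℕ} {A : Matrix (Fin n) (Fin m) ℝ} (h : IsTP A) : IsTP Aᵀ :=
  fun k f g => by rw [← transpose_submatrix, det_transpose]; exact h k g f

theorem isTN_one (n : ℕ) : IsTN (1 : Matrix (Fin n) (Fin n) ℝ) := by
  intro k f g
  by_cases h : f = g
  · subst h
    rw [submatrix_one f f.injective, det_one]
    exact zero_le_one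
  · have : ∃ p, f p ∉ Set.range g := by
      by_contra! hc
      apply h
      choose e he using hc
      have hes : StrictMono e := fun a b hab => by
        rw [← g.lt_iff_lt, he, he]; exact f.strictMono hab
      have : e = id := by
        have : Function.Surjective e := Finite.surjective_of_injective hes.injective
        -- A finite chain has only the trivial order automorphism.
        exact congrArg (fun x : Fin k ≃o Fin k => (x : Fin k → Fin k))
          (Subsingleton.elim (hes.orderIsoOfSurjective e this) (OrderIso.refl _))
      ext p : 1
      rw [← he p, this]; rfl
    obtain ⟨p, hp⟩ := this
    rw [det_eq_zero_of_row_eq_zero p]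
    intro j
    rw [submatrix_apply, one_apply_ne]
    exact fun e => hp ⟨j, e.symm⟩

theorem det_submatrix_diagonal_mul {n k : ℕ} (d : Fin n → ℝ) (M : Matrix (Fin n) (Fin n) ℝ)
    (f g : Fin k → Fin n) :
    ((diagonal d * M).submatrix f g).det = (∏ p, d (f p)) * (M.submatrix f g).det := by
  rw [← det_mul_column]
  congr 1
  ext a b
  simp [diagonal_mul]

theorem IsTN.diagonal_mul {n : ℕ} {d : Fin n → ℝ} (hd : ∀ k, 0 < d k)
    {M : Matrix (Fin n) (Fin n) ℝ} (h : IsTN M) : IsTN (diagonal d * M) := by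
  intro k f g
  rw [det_submatrix_diagonal_mul]
  exact mul_nonneg (Finset.prod_nonneg fun p _ => (hd _).le) (h k f g)

/-- By linearity in row `i`, the difference is `q` times the minor with row `i` replaced by row `i -
1`. If row `i - 1` is already chosen, two rows agree and this minor is zero; otherwise the rows are
still increasing and it is nonnegative. -/
theorem IsTN.det_submatrix_le_elemL_mul {n k i : ℕ} {q : ℝ} (hq : 0 < q)
    {M : Matrix (Fin n) (Fin n) ℝ} (h : IsTN M) {f g : Fin k → Fin n} (hf : StrictMono f)
    (hg : StrictMono g) :
    (M.submatrix f g).det ≤ ((elemL n i q * M).submatrix f g).det := by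
  rw [isTN_iff] at h
  by_cases hex : ∃ p, (f p : ℕ) + 1 = i ∧ 2 ≤ i
  · obtain ⟨p, hp, hi⟩ := hex
    let r : Fin n := ⟨i - 2, by have := (f p).2; omega⟩
    have hr : (r : ℕ) + 2 = i := by simp [r]; omega
    have hne : ∀ x, x ≠ p → Function.update f p r x = f x := fun x hx => by
      rw [Function.update_of_ne hx]
    rw [det_submatrix_elemL_mul (f' := Function.update f p r) M g hf.injective hp
      (by simpa using hr) hne]
    refine le_add_of_nonneg_right (mul_nonneg hq.le ?_)
    by_cases hex : ∃ p', f p' = r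
    · obtain ⟨p', hp'⟩ := hex
      have hpp : p' ≠ p := by rintro rfl; rw [hp'] at hp; omega
      rw [det_zero_of_row_eq hpp]
      ext c
      simp [hpp, hp']
    · refine h k _ g ?_ hg
      intro a b hab
      have h1 := hf hab
      by_cases ha : a = p
      · subst ha
        rw [Function.update_self, hne b hab.ne']
        simp only [Fin.lt_def] at h1 ⊢; omega
      · by_cases hb : b = p
        · subst hb
          rw [Function.update_self, hne a ha]
          have : (f a : ℕ) ≠ r := fun e => hex ⟨a, Fin.ext e⟩
          simp only [Fin.lt_def] at h1 ⊢; omega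
        · rw [hne a ha, hne b hb]; exact h1
  · push Not at hex
    refine le_of_eq (congrArg det ?_)
    ext a b
    rw [submatrix_apply, submatrix_apply, elemL_mul_apply_of_ne]
    rintro ⟨h1, h2⟩
    exact absurd (hex a h1) (by omega)

theorem IsTN.elemL_mul {n i : ℕ} {q : ℝ} (hq : 0 < q) {M : Matrix (Fin n) (Fin n) ℝ}
    (h : IsTN M) : IsTN (elemL n i q * M) :=
  fun k f g => (h k f g).trans (h.det_submatrix_le_elemL_mul hq f.strictMono g.strictMono)

theorem HasWord.isTN_mul {n : ℕ} {w : List ℕ} {L M : Matrix (Fin n) (Fin n) ℝ}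
    (hL : HasWord n w L) (hM : IsTN M) : IsTN (L * M) := by
  induction hL with
  | nil => simpa using hM
  | cons i q hq _ ih => rw [Matrix.mul_assoc]; exact ih.elemL_mul hq

theorem HasWord.isTN {n : ℕ} {w : List ℕ} {L : Matrix (Fin n) (Fin n) ℝ}
    (hL : HasWord n w L) : IsTN L := by
  simpa using hL.isTN_mul (isTN_one n)

/-! ### Carrying row sets along words: a criterion for total positivity. -/

/-- The word `w`, read from left to right, can carry the row set `f` to the row set `g`, where the
letter `i` may replace the row number `i` by the row number `i - 1`. -/
inductive Carries {n k : ℕ} : List ℕ → (Fin k → Fin n) → (Fin k → Fin n) → Prop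
  | nil (f) : Carries [] f f
  | skip {w f g} (i : ℕ) (h : Carries w f g) : Carries (i :: w) f g
  | move {w} {f f' g : Fin k → Fin n} (i : ℕ) (p : Fin k) (hf' : StrictMono f') (hp : (f p : ℕ) + 1 = i)
      (hp' : (f' p : ℕ) + 2 = i) (hne : ∀ r, r ≠ p → f' r = f r) (h : Carries w f' g) :
      Carries (i :: w) f g

theorem Carries.append {n k : ℕ} {w w' : List ℕ} {f g h : Fin k → Fin n} (h1 : Carries w f g)
    (h2 : Carries w' g h) : Carries (w ++ w') f h := by
  induction h1 with
  | nil => exact h2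
  | skip i _ ih => exact .skip i (ih h2)
  | move i p hf' hp hp' hne _ ih => exact .move i p hf' hp hp' hne (ih h2)

theorem Carries.sublist {n k : ℕ} {w w' : List ℕ} {f g : Fin k → Fin n} (h1 : Carries w f g)
    (h2 : List.Sublist w w') : Carries w' f g := by
  induction h2 generalizing f with
  | slnil => exact h1
  | cons i _ ih => exact .skip i (ih h1)
  | cons_cons i _ ih =>
    cases h1 with
    | skip _ h => exact .skip i (ih h)
    | move _ p hf' hp hp' hne h => exact .move i p hf' hp hp' hne (ih h)

theorem Carries.refl {n k : ℕ} (w : List ℕ) (f : Fin k → Fin n) : Carries w f f :=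
  (Carries.nil f).sublist (List.nil_sublist w)

/-- No cancellation occurs: each move selects one summand of a sum of nonnegative minors, and each
skip can only increase the minor. -/
theorem Carries.det_pos {n k : ℕ} {w : List ℕ} {f g : Fin k → Fin n} (h : Carries w f g)
    (hf : StrictMono f) {L M : Matrix (Fin n) (Fin n) ℝ} (hL : HasWord n w L) (hM : IsTN M)
    {c : Fin k → Fin n} (hc : StrictMono c) (hpos : 0 < (M.submatrix g c).det) :
    0 < ((L * M).submatrix f c).det := by
  induction h generalizing L with
  | nil f => cases hL; simpa using hpos
  | @skip w f g i h ih =>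
    cases hL with
    | @cons _ L' _ q hq hL' =>
    rw [Matrix.mul_assoc]
    exact (ih hf hL' hpos).trans_le ((hL'.isTN_mul hM).det_submatrix_le_elemL_mul hq hf hc)
  | @move w f f' g i p hf' hp hp' hne h ih =>
    cases hL with
    | @cons _ L' _ q hq hL' =>
    rw [Matrix.mul_assoc, det_submatrix_elemL_mul (L' * M) c hf.injective hp hp' hne]
    have h1 := isTN_iff.1 (hL'.isTN_mul hM) k f c hf hc
    have h2 := mul_pos hq (ih hf' hL' hpos)
    linarith

/-- The word `w` carries every row set to an initial segment. -/
def Sweeps (n : ℕ) (w : List ℕ) : Prop :=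
  ∀ (k : ℕ) (hk : k ≤ n) (f : Fin k → Fin n), StrictMono f → Carries w f (Fin.castLE hk)

theorem Sweeps.sublist {n : ℕ} {w w' : List ℕ} (h : Sweeps n w) (hw : List.Sublist w w') :
    Sweeps n w' := fun k hk f hf => (h k hk f hf).sublist hw

/-- The rows are carried to an initial segment by `L`, the columns to the same segment by `V`; what
remains is a principal minor of the identity times positive diagonal entries. -/
theorem isTP_of_sweeps {n : ℕ} {w w' : List ℕ} (hw : Sweeps n w) (hw' : Sweeps n w')
    {L V : Matrix (Fin n) (Fin n) ℝ} (hL : HasWord n w L) (hV : HasWord n w' V)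
    {d : Fin n → ℝ} (hd : ∀ k, 0 < d k) : IsTP (L * diagonal d * Vᵀ) := by
  rw [isTP_iff]
  intro k f g hf hg
  have hk : k ≤ n := by simpa using Fintype.card_le_of_injective f hf.injective
  have hc : StrictMono (Fin.castLE hk) := Fin.strictMono_castLE hk
  rw [Matrix.mul_assoc]
  refine (hw k hk f hf).det_pos hf hL (hV.isTN.transpose.diagonal_mul hd) hg ?_
  rw [det_submatrix_diagonal_mul, ← transpose_submatrix, det_transpose]
  refine mul_pos (Finset.prod_pos fun p _ => hd _) ?_
  have := (hw' k hk g hg).det_pos hg hV (isTN_one n) hc (by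
    rw [submatrix_one _ hc.injective, det_one]; exact one_pos)
  simpa using this

/-! ### Sweeping with the words of the two families. -/

theorem descWord_cons {n i : ℕ} (h : i ≤ n) (m : ℕ) (hm : n = m + 1) :
    descWord n i = n :: descWord m i := by
  subst hm
  rw [descWord, show m + 1 + 1 - i = (m + 1 - i) + 1 by omega, List.range_succ_eq_map]
  simp [descWord, Function.comp_def]

theorem descWord_sublist (n : ℕ) {i j : ℕ} (h : i ≤ j) :
    List.Sublist (descWord n j) (descWord n i) :=
  (List.range_sublist.2 (by omega)).map _

theorem descWord_sublist_left {m n : ℕ} (i : ℕ) (h : m ≤ n) :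
    List.Sublist (descWord m i) (descWord n i) := by
  induction n, h using Nat.le_induction with
  | base => exact List.Sublist.refl _
  | succ n _ ih =>
    by_cases hi : i ≤ n + 1
    · rw [descWord_cons hi n rfl]
      exact ih.trans (List.sublist_cons_self _ _)
    · have : descWord m i = [] := by
        rw [descWord, show m + 1 - i = 0 by omega]; rfl
      rw [this]
      exact List.nil_sublist _

/-- A decreasing word carries a single row down past unoccupied rows. -/
theorem carries_descWord_aux {n k : ℕ} (p : Fin k) (b : ℕ) (v : ℕ) :
    ∀ {f g : Fin k → Fin n}, StrictMono f → StrictMono g → (f p : ℕ) = b + v → (g p : ℕ) = b →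
      (∀ r, r ≠ p → g r = f r) → Carries (descWord (b + v + 1) (b + 2)) f g := by
  induction v with
  | zero =>
    intro f g _ _ h1 h2 h3
    have : f = g := by
      ext r : 1
      by_cases hr : r = p
      · subst hr; exact Fin.ext (by omega)
      · exact (h3 r hr).symm
    rw [this]
    exact Carries.refl _ _
  | succ v ih =>
    intro f g hf hg h1 h2 h3
    let r : Fin n := ⟨b + v, by have := (f p).2; omega⟩
    have hne : ∀ x, x ≠ p → Function.update f p r x = f x := fun x hx => by
      rw [Function.update_of_ne hx]
    have hself : Function.update f p r p = r := Function.update_self ..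
    have hmono : StrictMono (Function.update f p r) := by
      intro x y hxy
      have hfxy := hf hxy
      have hgxy := hg hxy
      by_cases hx : x = p
      · subst hx
        rw [hself, hne y hxy.ne']
        simp only [Fin.lt_def] at hfxy ⊢; simp only [r]; omega
      · by_cases hy : y = p
        · subst hy
          rw [hself, hne x hx]
          rw [h3 x hx] at hgxy
          simp only [Fin.lt_def] at hgxy ⊢; simp only [r]; omega
        · rw [hne x hx, hne y hy]; exact hfxy
    rw [← Nat.add_assoc b v 1, descWord_cons (by omega) (b + v + 1) rfl]
    refine .move _ p hmono (by omega) (by rw [hself]) hne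
      (ih hmono hg (by rw [hself]) h2 fun x hx => ?_)
    rw [hne x hx, h3 x hx]

theorem carries_descWord {n k : ℕ} {f g : Fin k → Fin n} (hf : StrictMono f) (hg : StrictMono g)
    (p : Fin k) {i : ℕ} (hi : (g p : ℕ) + 2 = i) (hle : g p ≤ f p)
    (hne : ∀ r, r ≠ p → g r = f r) : Carries (descWord n i) f g := by
  have hle' : (g p : ℕ) ≤ f p := hle
  have h := carries_descWord_aux p (g p) (f p - g p) hf hg (by omega) rfl hne
  rw [hi] at h
  exact h.sublist (descWord_sublist_left _ (by have := (f p).2; omega))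

theorem le_val_of_strictMono {n k : ℕ} {f : Fin k → Fin n} (hf : StrictMono f) (p : Fin k) :
    (p : ℕ) ≤ f p := by
  obtain ⟨p, hp⟩ := p
  induction p with
  | zero => exact Nat.zero_le _
  | succ p ih =>
    have h1 := ih (by omega)
    have h2 : f ⟨p, by omega⟩ < f ⟨p + 1, hp⟩ := hf (by simp [Fin.lt_def])
    simp only [Fin.lt_def] at h2 h1 ⊢
    omega

/-- `f`, with the first `j` values cut off at `c, c+1, …`. -/
def cut {n k : ℕ} (f : Fin k → Fin n) (c j : ℕ) : Fin k → Fin n :=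
  fun p => ⟨if (p : ℕ) < j then min (f p) (c + p) else f p, by
    have := (f p).2
    split_ifs <;> omega⟩

theorem cut_val {n k : ℕ} (f : Fin k → Fin n) (c j : ℕ) (p : Fin k) :
    (cut f c j p : ℕ) = if (p : ℕ) < j then min (f p : ℕ) (c + p) else f p := rfl

theorem strictMono_cut {n k : ℕ} {f : Fin k → Fin n} (hf : StrictMono f) (c j : ℕ) :
    StrictMono (cut f c j) := by
  intro a b hab
  have h := hf hab
  simp only [Fin.lt_def, cut_val] at h hab ⊢
  split_ifs <;> omega

theorem cut_zero {n k : ℕ} (f : Fin k → Fin n) (c : ℕ) : cut f c 0 = f := by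
  ext p; simp [cut_val]

theorem cut_succ_of_ne {n k : ℕ} (f : Fin k → Fin n) (c j : ℕ) {r : Fin k} (h : (r : ℕ) ≠ j) :
    cut f c (j + 1) r = cut f c j r := by
  refine Fin.ext ?_
  rw [cut_val, cut_val]
  split_ifs <;> omega

/-- The rows are lowered one at a time from the smallest: the descending word ending in `c + p + 2`
brings the `p`-th row to `c + p`, past places that are free because the smaller rows have already
moved. -/
theorem carries_flatMap_descWord_cut {n k : ℕ} {f : Fin k → Fin n} (hf : StrictMono f) (c N : ℕ)
    (hN : c + N < n) :
    Carries ((List.range' (c + 2) N).flatMap (descWord n)) f (cut f c N) := by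
  induction N with
  | zero => rw [cut_zero]; exact Carries.refl _ _
  | succ N ih =>
    rw [List.range'_1_concat, List.flatMap_append]
    refine (ih (by omega)).append ?_
    simp only [List.flatMap_cons, List.flatMap_nil, List.append_nil]
    by_cases hex : ∃ p : Fin k, (p : ℕ) = N ∧ c + p ≤ f p
    · obtain ⟨p, hp, hle⟩ := hex
      have h1 : (cut f c (N + 1) p : ℕ) = c + p := by rw [cut_val]; split_ifs <;> omega
      have h2 : (cut f c N p : ℕ) = f p := by rw [cut_val]; split_ifs <;> omega
      refine carries_descWord (strictMono_cut hf _ _) (strictMono_cut hf _ _) p (by omega) ?_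
        fun r hr => cut_succ_of_ne f c N fun h => hr (Fin.ext (by omega))
      rw [Fin.le_def]; omega
    · have : cut f c (N + 1) = cut f c N := by
        ext p
        by_cases hp : (p : ℕ) = N
        · have : ¬ c + p ≤ f p := fun h => hex ⟨p, hp, h⟩
          rw [cut_val, cut_val]
          split_ifs <;> omega
        · rw [cut_succ_of_ne f c N hp]
      rw [this]
      exact Carries.refl _ _

/-- `f`, with all values cut off at `c, c+1, …`. -/
def cutAll {n k : ℕ} (f : Fin k → Fin n) (c : ℕ) : Fin k → Fin n :=
  fun p => ⟨min (f p) (c + p), by have := (f p).2; omega⟩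

theorem cutAll_val {n k : ℕ} (f : Fin k → Fin n) (c : ℕ) (p : Fin k) :
    (cutAll f c p : ℕ) = min (f p : ℕ) (c + p) := rfl

theorem strictMono_cutAll {n k : ℕ} {f : Fin k → Fin n} (hf : StrictMono f) (c : ℕ) :
    StrictMono (cutAll f c) := by
  intro a b hab
  have h := hf hab
  simp only [Fin.lt_def, cutAll_val] at h hab ⊢
  omega

theorem cutAll_zero {n k : ℕ} {f : Fin k → Fin n} (hf : StrictMono f) (hk : k ≤ n) :
    cutAll f 0 = Fin.castLE hk := by
  ext p
  have := le_val_of_strictMono hf p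
  rw [cutAll_val, Fin.val_castLE]
  omega

theorem carries_cutAll {n k : ℕ} {f : Fin k → Fin n} (hf : StrictMono f) {c : ℕ} (hc : c < n) :
    Carries ((List.range' (c + 2) (n - 1 - c)).flatMap (descWord n)) f (cutAll f c) := by
  convert carries_flatMap_descWord_cut hf c (n - 1 - c) (by omega) using 1
  ext p
  have := (f p).2
  rw [cutAll_val, cut_val]
  split_ifs <;> omega

theorem sweeps_flatMap_descWord {n : ℕ} (hn : 1 ≤ n) :
    Sweeps n ((List.range' 2 (n - 1)).flatMap (descWord n)) := by
  intro k hk f hf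
  rw [← cutAll_zero hf hk]
  exact carries_cutAll hf hn

/-- Every row is at most one step above its target, so one increasing pass suffices: the letter `c +
p + 2` moves the `p`-th row after the smaller rows have made room. -/
theorem carries_range'_cut {n k : ℕ} {f : Fin k → Fin n} (hf : StrictMono f) (c N : ℕ)
    (h : ∀ p, (f p : ℕ) ≤ c + 1 + p) :
    -- The first `c` letters `2, …, c + 1` are skipped, hence the truncated difference.
    Carries (List.range' 2 N) f (cut f c (N - c)) := by
  induction N with
  | zero => rw [Nat.zero_sub, cut_zero]; exact Carries.refl _ _
  | succ N ih =>
    rw [List.range'_1_concat]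
    refine ih.append ?_
    by_cases hex : ∃ p : Fin k, c + p = N ∧ c + p + 1 ≤ f p
    · obtain ⟨p, hp, hle⟩ := hex
      have h1 : (cut f c (N + 1 - c) p : ℕ) = c + p := by rw [cut_val]; split_ifs <;> omega
      have h2 : (cut f c (N - c) p : ℕ) = f p := by rw [cut_val]; split_ifs <;> omega
      have h3 := h p
      refine .move _ p (strictMono_cut hf _ _) (by omega) (by omega) (fun r hr => ?_) (.nil _)
      rw [show N + 1 - c = N - c + 1 by omega]
      exact cut_succ_of_ne f c _ fun h => hr (Fin.ext (by omega))
    · have : cut f c (N + 1 - c) = cut f c (N - c) := by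
        ext p
        rw [cut_val, cut_val]
        by_cases hp : c + p = N
        · have : ¬ c + p + 1 ≤ f p := fun h => hex ⟨p, hp, h⟩
          split_ifs <;> omega
        · split_ifs <;> omega
      rw [this]
      exact Carries.refl _ _

theorem carries_range'_cutAll {n k : ℕ} {f : Fin k → Fin n} (hf : StrictMono f) (c : ℕ) :
    Carries (List.range' 2 (n - 1)) (cutAll f (c + 1)) (cutAll f c) := by
  convert carries_range'_cut (strictMono_cutAll hf (c + 1)) c (n - 1) (fun p => ?_) using 1
  · ext p
    have := (f p).2
    rw [cutAll_val, cut_val, cutAll_val]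
    split_ifs <;> omega
  · rw [cutAll_val]; omega

theorem sublist_flatMap {l : List ℕ} {F : ℕ → List ℕ} (h : ∀ i ∈ l, i ∈ F i) :
    List.Sublist l (l.flatMap F) := by
  induction l with
  | nil => exact List.nil_sublist _
  | cons a l ih =>
    rw [List.flatMap_cons]
    exact (List.singleton_sublist.2 (h a (by simp))).append (ih fun i hi => h i (by simp [hi]))

theorem flatMap_descWord_sublist (n a c N : ℕ) :
    List.Sublist ((List.range' (a + c) N).flatMap (descWord n))
      ((List.range' a N).flatMap (descWord n)) := by
  induction N generalizing a with
  | zero => exact List.Sublist.refl _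
  | succ N ih =>
    rw [List.range'_succ, List.range'_succ, List.flatMap_cons, List.flatMap_cons]
    refine (descWord_sublist n (by omega)).append ?_
    rw [show a + c + 1 = a + 1 + c by omega]
    exact ih (a + 1)

/-- The word of the class `Z_1(s)`. -/
def wordOne (n s : ℕ) : List ℕ := (List.range' 2 (s - 1)).flatMap (descWord n)

/-- The word of `W_{i+c}` is a subword of that of `W_i`, so each new copy of `W_2 ⋯ W_s` can serve
as the next `s - 1` blocks of a longer staircase. -/
theorem flatMap_sublist_wordPow (n s m : ℕ) :
    List.Sublist ((List.range' 2 (m * (s - 1))).flatMap (descWord n)) (wordPow (wordOne n s) m) := by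
  induction m with
  | zero => simp
  | succ m ih =>
    rw [wordPow_succ', Nat.succ_mul, ← List.range'_append_1, List.flatMap_append]
    exact ih.append (flatMap_descWord_sublist n 2 _ _)

theorem sweeps_wordPow_wordOne {n s m : ℕ} (hn : 1 ≤ n) (h : n - 1 ≤ m * (s - 1)) :
    Sweeps n (wordPow (wordOne n s) m) := by
  refine (sweeps_flatMap_descWord hn).sublist (List.Sublist.trans ?_ (flatMap_sublist_wordPow n s m))
  obtain ⟨c, hc⟩ := Nat.exists_eq_add_of_le h
  rw [hc, ← List.range'_append_1, List.flatMap_append]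
  exact List.sublist_append_left _ _

/-- The words of the class `Z_2(s)`, `s ≥ 3`; the word `u` comes from the factor in `Ψ_{s-1}`. -/
def wordTwo (n s : ℕ) (u : List ℕ) : List ℕ :=
  List.range' 2 (s - 3) ++ u ++ (List.range' s (n + 1 - s)).flatMap (descWord n)

theorem range'_sublist_wordTwo {n s : ℕ} (hs : 3 ≤ s) (hsn : s ≤ n) {u : List ℕ}
    (hu : s - 1 ∈ u) : List.Sublist (List.range' 2 (n - 1)) (wordTwo n s u) := by
  have : List.range' 2 (n - 1) = List.range' 2 (s - 3) ++ [s - 1] ++ List.range' s (n + 1 - s) := by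
    have h1 : List.range' 2 (s - 3) ++ [s - 1] = List.range' 2 (s - 3 + 1) := by
      rw [List.range'_1_concat, show 2 + (s - 3) = s - 1 by omega]
    rw [h1]
    have h2 := List.range'_append_1 (s := 2) (m := s - 3 + 1) (n := n + 1 - s)
    rw [show 2 + (s - 3 + 1) = s by omega] at h2
    rw [h2]
    congr 1
    omega
  rw [this]
  refine ((List.Sublist.refl _).append (List.singleton_sublist.2 hu)).append
    (sublist_flatMap fun i hi => ?_)
  rw [List.mem_range'_1] at hi
  rw [mem_descWord (by omega)]
  omega

/-- The block `W_s ⋯ W_n` of the first copy cuts at `s - 2`; each later copy contains the increasing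
word `2, …, n` and lowers the cut by one. -/
theorem carries_wordPow_wordTwo {n s : ℕ} (hs : 3 ≤ s) (hsn : s ≤ n) {u : List ℕ}
    (hu : s - 1 ∈ u) {k : ℕ} {f : Fin k → Fin n} (hf : StrictMono f) {m c : ℕ}
    (hm : m + c = s - 2) : Carries (wordPow (wordTwo n s u) (m + 1)) f (cutAll f c) := by
  induction m generalizing c with
  | zero =>
    have h1 := carries_cutAll hf (c := c) (by omega)
    rw [show c + 2 = s by omega, show n - 1 - c = n + 1 - s by omega] at h1
    simp only [wordPow, zero_add, List.replicate_one, List.flatten_singleton, wordTwo]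
    exact h1.sublist (List.sublist_append_right _ _)
  | succ m ih =>
    rw [wordPow_succ']
    exact (ih (c := c + 1) (by omega)).append
      ((carries_range'_cutAll hf c).sublist (range'_sublist_wordTwo hs hsn hu))

theorem sweeps_wordPow_wordTwo {n s m : ℕ} (hs : 3 ≤ s) (hsn : s ≤ n) {u : List ℕ}
    (hu : s - 1 ∈ u) (hm : s - 1 ≤ m) : Sweeps n (wordPow (wordTwo n s u) m) := by
  refine Sweeps.sublist ?_ (wordPow_sublist _ hm)
  intro k hk f hf
  rw [← cutAll_zero hf hk, show s - 1 = s - 2 + 1 by omega]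
  exact carries_wordPow_wordTwo hs hsn hu hf rfl

/-! ### Lower bound for `Z_2`: a vanishing corner entry. -/

theorem HasWord.of_append {n : ℕ} {w w' : List ℕ} {M : Matrix (Fin n) (Fin n) ℝ}
    (h : HasWord n (w ++ w') M) :
    ∃ M₁ M₂, HasWord n w M₁ ∧ HasWord n w' M₂ ∧ M = M₁ * M₂ := by
  induction w generalizing M with
  | nil => exact ⟨1, M, .nil, h, by simp⟩
  | cons i w ih =>
    cases h with
    | @cons _ M' _ q hq h =>
    obtain ⟨M₁, M₂, h1, h2, rfl⟩ := ih h
    exact ⟨_, M₂, .cons i q hq h1, h2, by rw [Matrix.mul_assoc]⟩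

/-- The coordinates of `y` before the `t`-th (numbered from one) vanish. -/
def ZeroBefore {n : ℕ} (t : ℕ) (y : Fin n → ℝ) : Prop := ∀ a : Fin n, (a : ℕ) + 1 < t → y a = 0

theorem ZeroBefore.mono {n t t' : ℕ} {y : Fin n → ℝ} (h : ZeroBefore t y) (ht : t' ≤ t) :
    ZeroBefore t' y := fun a ha => h a (by omega)

/-- In a row vector the letter `i` adds a multiple of coordinate `i` to coordinate `i - 1`, so only
the letter `t` can carry the support below `t`. -/
theorem ZeroBefore.vecMul {n t : ℕ} {y : Fin n → ℝ} (h : ZeroBefore t y) {w : List ℕ}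
    {M : Matrix (Fin n) (Fin n) ℝ} (hM : HasWord n w M) (ht : t ∉ w) : ZeroBefore t (y ᵥ* M) := by
  induction hM generalizing y with
  | nil => simpa using h
  | cons i q hq _ ih =>
    rw [← vecMul_vecMul]
    refine ih (fun b hb => ?_) fun h' => ht (by simp [h'])
    rw [elemL, vecMul_add, vecMul_one, Pi.add_apply, h b hb, zero_add]
    change ∑ a, y a * _ = 0
    refine Finset.sum_eq_zero fun a _ => ?_
    by_cases hab : (a : ℕ) + 1 = i ∧ (b : ℕ) + 2 = i
    · have : i ≠ t := fun e => ht (by simp [e])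
      rw [h a (by omega), zero_mul]
    · rw [of_apply, if_neg hab, mul_zero]

/-- The letter `t ≤ s - 1` follows the only possible occurrence of `t - 1`, so after descending to
`t - 1` the support can go no further in this copy. -/
theorem ZeroBefore.vecMul_wordTwo {n s t : ℕ} {u : List ℕ} (hu : ∀ i ∈ u, s - 1 ≤ i)
    {y : Fin n → ℝ} (h : ZeroBefore t y) (ht : t ≤ s - 1) (ht2 : 2 ≤ t)
    {M : Matrix (Fin n) (Fin n) ℝ} (hM : HasWord n (wordTwo n s u) M) :
    ZeroBefore (t - 1) (y ᵥ* M) := by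
  have hsplit : List.range' 2 (s - 3) = List.range' 2 (t - 2) ++ List.range' t (s - 1 - t) := by
    have := List.range'_append_1 (s := 2) (m := t - 2) (n := s - 1 - t)
    rw [show 2 + (t - 2) = t by omega] at this
    rw [this]
    congr 1
    omega
  rw [wordTwo, hsplit, List.append_assoc, List.append_assoc] at hM
  obtain ⟨M₁, M₂, h1, h2, rfl⟩ := hM.of_append
  rw [← vecMul_vecMul]
  refine ((h.vecMul h1 ?_).mono (Nat.sub_le t 1)).vecMul h2 ?_
  · rw [List.mem_range'_1]; omega
  · simp only [List.mem_append, List.mem_range'_1, List.mem_flatMap, not_or, not_exists, not_and]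
    refine ⟨by omega, fun h => by have := hu _ h; omega, fun i hi h => ?_⟩
    rw [mem_descWord (by omega)] at h
    omega

/-- The missing letter `j` blocks the support at `j` until `W_s ⋯ W_n` begins, and that block has no
letter `s - 1`. -/
theorem ZeroBefore.vecMul_wordTwo_of_last {n s j : ℕ} (hs : 3 ≤ s) {u : List ℕ} (hj : s ≤ j)
    (hjn : j ≤ n) (hju : j ∉ u) {y : Fin n → ℝ} (h : ZeroBefore n y)
    {M : Matrix (Fin n) (Fin n) ℝ} (hM : HasWord n (wordTwo n s u) M) :
    ZeroBefore (s - 1) (y ᵥ* M) := by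
  obtain ⟨M₁, M₂, h1, h2, rfl⟩ := hM.of_append
  rw [← vecMul_vecMul]
  refine (((h.mono hjn).vecMul h1 ?_).mono (by omega)).vecMul h2 ?_
  · simp only [List.mem_append, List.mem_range'_1, not_or]
    exact ⟨by omega, hju⟩
  · simp only [List.mem_flatMap, List.mem_range'_1, not_exists, not_and]
    intro i hi h
    rw [mem_descWord (by omega)] at h
    omega

theorem ZeroBefore.vecMul_wordPow_wordTwo {n s j : ℕ} (hs : 3 ≤ s) {u : List ℕ}
    (hu : ∀ i ∈ u, s - 1 ≤ i) (hj : s ≤ j) (hjn : j ≤ n) (hju : j ∉ u) {y : Fin n → ℝ}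
    (h : ZeroBefore n y) (m : ℕ) {M : Matrix (Fin n) (Fin n) ℝ}
    (hM : HasWord n (wordPow (wordTwo n s u) (m + 1)) M) :
    ZeroBefore (s - 1 - m) (y ᵥ* M) := by
  induction m generalizing M with
  | zero =>
    rw [wordPow, List.replicate_one, List.flatten_singleton] at hM
    exact h.vecMul_wordTwo_of_last hs hj hjn hju hM
  | succ m ih =>
    rw [wordPow_succ'] at hM
    obtain ⟨M₁, M₂, h1, h2, rfl⟩ := hM.of_append
    rw [← vecMul_vecMul]
    by_cases ht : 2 ≤ s - 1 - m
    · exact (ih h1).vecMul_wordTwo hu (by omega) ht h2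
    · intro a ha; omega

theorem HasWord.row_zero {n : ℕ} {w : List ℕ} {M : Matrix (Fin n) (Fin n) ℝ}
    (h : HasWord n w M) {a : Fin n} (ha : (a : ℕ) = 0) (b : Fin n) :
    M a b = (1 : Matrix (Fin n) (Fin n) ℝ) a b := by
  induction h with
  | nil => rfl
  | cons i q _ _ ih => rw [elemL_mul_apply_of_ne _ (by omega), ih]

theorem HasWord.col_last {n : ℕ} {w : List ℕ} {M : Matrix (Fin n) (Fin n) ℝ}
    (h : HasWord n w M) {b : Fin n} (hb : (b : ℕ) + 1 = n) (a : Fin n) :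
    M a b = (1 : Matrix (Fin n) (Fin n) ℝ) a b := by
  induction h generalizing a with
  | nil => rfl
  | @cons w M i q _ _ ih =>
    by_cases ha : (a : ℕ) + 1 = i ∧ 2 ≤ i
    · have hr : ((⟨i - 2, by have := a.2; omega⟩ : Fin n) : ℕ) + 2 = i := by
        simp only; omega
      rw [elemL_mul_apply M ha.1 hr, ih, ih, one_apply_ne (i := (⟨i - 2, _⟩ : Fin n)), mul_zero,
        add_zero]
      rw [Ne, Fin.ext_iff]
      have := a.2
      simp only; omega
    · rw [elemL_mul_apply_of_ne _ ha, ih]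

theorem le_of_isTP_wordTwo {n s j m : ℕ} (hs : 3 ≤ s) {u : List ℕ}
    (hu : ∀ i ∈ u, s - 1 ≤ i) (hj : s ≤ j) (hjn : j ≤ n) (hju : j ∉ u) (hm : 1 ≤ m)
    {L V : Matrix (Fin n) (Fin n) ℝ} {w : List ℕ} {d : Fin n → ℝ}
    (hL : HasWord n (wordPow (wordTwo n s u) m) L) (hV : HasWord n w V)
    (hTP : IsTP (L * diagonal d * Vᵀ)) : s - 1 ≤ m := by
  by_contra! hlt
  let e : Fin n := ⟨n - 1, by omega⟩
  let z : Fin n := ⟨0, by omega⟩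
  obtain ⟨m, rfl⟩ := Nat.exists_eq_add_of_le' hm
  have h0 : ZeroBefore n (Pi.single e (1 : ℝ)) := by
    intro a ha
    rw [Pi.single_eq_of_ne]
    rw [Ne, Fin.ext_iff]; simp only [e]; omega
  have h1 := h0.vecMul_wordPow_wordTwo hs hu hj hjn hju m hL z (by simp only [z]; omega)
  rw [single_one_vecMul] at h1
  have h2 := isTP_iff.1 hTP 1 (fun _ => e) (fun _ => z) (Subsingleton.strictMono _)
    (Subsingleton.strictMono _)
  -- The first column of `Vᵀ` is the first unit vector, so the corner entry is that of `L` times a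
  -- diagonal entry.
  rw [det_fin_one, submatrix_apply, mul_apply, Finset.sum_eq_single z] at h2
  · rw [mul_diagonal, show L e z = 0 from h1] at h2
    simp at h2
  · intro b _ hb
    rw [transpose_apply, hV.row_zero rfl, one_apply_ne hb.symm, mul_zero]
  · simp

/-! ### Lower bound for `Z_1`: a singular minor. -/

theorem elemL_mulVec_apply_of_ne {n i : ℕ} {q : ℝ} (y : Fin n → ℝ) {a : Fin n}
    (h : ¬ ((a : ℕ) + 1 = i ∧ 2 ≤ i)) : (elemL n i q *ᵥ y) a = y a :=
  elemL_mul_apply_of_ne (of fun a _ => y a) h a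

theorem elemL_mulVec_apply {n i : ℕ} {q : ℝ} (y : Fin n → ℝ) {a r : Fin n}
    (ha : (a : ℕ) + 1 = i) (hr : (r : ℕ) + 2 = i) :
    (elemL n i q *ᵥ y) a = y a + q * y r :=
  elemL_mul_apply (of fun a _ => y a) ha hr a

theorem elemL_mul_elemL_neg (n i : ℕ) (q : ℝ) : elemL n i q * elemL n i (-q) = 1 := by
  by_cases h : 2 ≤ i ∧ i ≤ n
  · let r : Fin n := ⟨i - 1, by omega⟩
    let p : Fin n := ⟨i - 2, by omega⟩
    have hr : (r : ℕ) + 1 = i := by simp [r]; omega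
    have hp : (p : ℕ) + 2 = i := by simp [p]; omega
    have hpr : p ≠ r := by rw [Ne, Fin.ext_iff]; omega
    rw [elemL_eq_single r p hr hp, elemL_eq_single r p hr hp, mul_add, add_mul, add_mul, mul_one,
      one_mul, mul_one, single_mul_single_of_ne _ _ _ _ hpr, add_zero, add_assoc,
      ← single_add, add_neg_cancel, single_zero, add_zero]
  · simp [elemL_eq_one_of_not h]

theorem HasWord.isUnit {n : ℕ} {w : List ℕ} {M : Matrix (Fin n) (Fin n) ℝ}
    (h : HasWord n w M) : IsUnit M := by
  induction h with
  | nil => exact isUnit_one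
  | cons i q _ _ ih =>
    refine IsUnit.mul ?_ ih
    exact (isUnit_iff_isUnit_det _).2 (isUnit_det_of_right_inverse (elemL_mul_elemL_neg n i q))

/-- The coordinates of `y` after the `t`-th (numbered from one) vanish. -/
def ZeroAfter {n : ℕ} (t : ℕ) (y : Fin n → ℝ) : Prop := ∀ a : Fin n, t ≤ (a : ℕ) → y a = 0

/-- Solving for `x` applies the inverse factors with the largest index first, each passing a
coordinate to the next higher one; as the indices decrease, the support grows by at most one. The
bound `c` on the remaining letters records that coordinate `t` (from zero) is still zero as long as
letters above `t` may occur. -/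
theorem exists_mulVec_eq_of_pairwise {n t : ℕ} {w : List ℕ} {M : Matrix (Fin n) (Fin n) ℝ}
    (hM : HasWord n w M) (hw : w.Pairwise (· > ·)) (c : ℕ) (hc : ∀ i ∈ w, i ≤ c)
    {y : Fin n → ℝ} (hy : ZeroAfter (t + 1) y) (hy' : ∀ a : Fin n, (a : ℕ) = t → t < c → y a = 0) :
    ∃ x, M *ᵥ x = y ∧ ZeroAfter (t + 1) x := by
  induction hM generalizing c y with
  | nil => exact ⟨y, by simp, hy⟩
  | @cons w M i q _ _ ih =>
    rw [List.pairwise_cons] at hw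
    have hic := hc i (by simp)
    have h1 : ZeroAfter (t + 1) (elemL n i (-q) *ᵥ y) := by
      intro a ha
      by_cases h : (a : ℕ) + 1 = i ∧ 2 ≤ i
      · let r : Fin n := ⟨i - 2, by have := a.2; omega⟩
        have hr : (r : ℕ) + 2 = i := by simp only [r]; omega
        rw [elemL_mulVec_apply y h.1 hr, hy a ha]
        by_cases h2 : t + 1 ≤ r
        · rw [hy r h2]; simp
        · rw [hy' r (by omega) (by omega)]; simp
      · rw [elemL_mulVec_apply_of_ne y h, hy a ha]
    have h2 : ∀ a : Fin n, (a : ℕ) = t → t < i - 1 → (elemL n i (-q) *ᵥ y) a = 0 := by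
      intro a ha hti
      rw [elemL_mulVec_apply_of_ne y (by omega), hy' a ha (by omega)]
    obtain ⟨x, hx, hx'⟩ := ih hw.2 (i - 1) (fun k hk => by have := hw.1 k hk; omega) h1 h2
    refine ⟨x, ?_, hx'⟩
    rw [← mulVec_mulVec, hx, mulVec_mulVec, elemL_mul_elemL_neg, one_mulVec]

theorem pairwise_descWord (n : ℕ) {i : ℕ} (hi : 1 ≤ i) : (descWord n i).Pairwise (· > ·) := by
  rw [descWord, List.pairwise_map]
  refine List.Pairwise.imp_of_mem ?_ List.pairwise_lt_range
  intro a b ha hb hab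
  rw [List.mem_range] at ha hb
  omega

theorem exists_mulVec_eq_of_flatMap {n t : ℕ} (l : List ℕ) (hl : ∀ i ∈ l, 1 ≤ i)
    {M : Matrix (Fin n) (Fin n) ℝ}
    (hM : HasWord n (l.flatMap (descWord n)) M) {y : Fin n → ℝ} (hy : ZeroAfter t y) :
    ∃ x, M *ᵥ x = y ∧ ZeroAfter (t + l.length) x := by
  induction l generalizing M y t with
  | nil => cases hM; exact ⟨y, by simp, hy⟩
  | cons i l ih =>
    rw [List.flatMap_cons] at hM
    obtain ⟨M₁, M₂, h1, h2, rfl⟩ := hM.of_append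
    have hi := hl i (by simp)
    obtain ⟨x, hx, hx'⟩ := exists_mulVec_eq_of_pairwise (t := t) h1 (pairwise_descWord n hi) n
      (fun k hk => ((mem_descWord hi).1 hk).2)
      (fun a ha => hy a (by omega)) (fun a ha _ => hy a ha.ge)
    obtain ⟨z, hz, hz'⟩ := ih (fun i hi => hl i (by simp [hi])) h2 hx'
    refine ⟨z, by rw [← mulVec_mulVec, hz, hx], ?_⟩
    rw [List.length_cons, show t + (l.length + 1) = t + 1 + l.length by omega]
    exact hz'

theorem exists_mulVec_eq_wordPow_wordOne {n s t : ℕ} (m : ℕ) {M : Matrix (Fin n) (Fin n) ℝ}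
    (hM : HasWord n (wordPow (wordOne n s) m) M) {y : Fin n → ℝ} (hy : ZeroAfter t y) :
    ∃ x, M *ᵥ x = y ∧ ZeroAfter (t + m * (s - 1)) x := by
  induction m generalizing M y t with
  | zero =>
    rw [wordPow, List.replicate_zero, List.flatten_nil] at hM
    cases hM
    exact ⟨y, by simp, by simpa using hy⟩
  | succ m ih =>
    rw [wordPow_succ] at hM
    obtain ⟨M₁, M₂, h1, h2, rfl⟩ := hM.of_append
    obtain ⟨x, hx, hx'⟩ := exists_mulVec_eq_of_flatMap _ (fun i hi => by
      rw [List.mem_range'_1] at hi; omega) h1 hy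
    rw [List.length_range'] at hx'
    obtain ⟨z, hz, hz'⟩ := ih h2 hx'
    refine ⟨z, by rw [← mulVec_mulVec, hz, hx], ?_⟩
    rw [Nat.succ_mul, show t + (m * (s - 1) + (s - 1)) = t + (s - 1) + m * (s - 1) by omega]
    exact hz'

/-- Dropping the zero last entry of `z` leaves a nonzero kernel vector of the submatrix without
first row and last column. -/
theorem not_isTP_of_mulVec_eq_single {n : ℕ} {A : Matrix (Fin (n + 1)) (Fin (n + 1)) ℝ}
    {z : Fin (n + 1) → ℝ} (h : A *ᵥ z = Pi.single 0 1) (hz : z (Fin.last n) = 0) : ¬ IsTP A := by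
  intro hTP
  have h1 := isTP_iff.1 hTP n Fin.succ Fin.castSucc (Fin.strictMono_succ) (Fin.strictMono_castSucc)
  refine h1.ne' (exists_mulVec_eq_zero_iff.1 ⟨fun i => z i.castSucc, ?_, ?_⟩)
  · intro h0
    have : z = 0 := by
      ext i
      refine Fin.lastCases hz (fun i => congrFun h0 i) i
    rw [this, mulVec_zero] at h
    have := congrFun h 0
    simp at this
  · ext i
    have h2 := congrFun h i.succ
    rw [mulVec, dotProduct, Fin.sum_univ_castSucc, hz, mul_zero, add_zero,
      Pi.single_eq_of_ne (Fin.succ_ne_zero i)] at h2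
    exact h2

theorem le_of_isTP_wordOne {n s m : ℕ} {L V : Matrix (Fin n) (Fin n) ℝ} {w : List ℕ}
    {d : Fin n → ℝ} (hd : ∀ k, 0 < d k) (hL : HasWord n (wordPow (wordOne n s) m) L)
    (hV : HasWord n w V) (hTP : IsTP (L * diagonal d * Vᵀ)) : n - 1 ≤ m * (s - 1) := by
  by_contra! hlt
  obtain ⟨n, rfl⟩ : ∃ k, n = k + 1 := ⟨n - 1, by omega⟩
  obtain ⟨x, hx, hx'⟩ := exists_mulVec_eq_wordPow_wordOne (t := 1) m hL
    (y := Pi.single 0 1) (fun a ha => by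
      rw [Pi.single_eq_of_ne]; rintro rfl; simp at ha)
  have hU : IsUnit (diagonal d * Vᵀ) := by
    refine IsUnit.mul ?_ (by simpa using hV.isUnit)
    rw [isUnit_iff_isUnit_det, det_diagonal]
    exact (Finset.prod_pos fun k _ => hd k).ne'.isUnit
  -- The last row of `Vᵀ` is the last unit vector, so the vanishing of the last coordinate passes
  -- from `x` to `z`.
  obtain ⟨z, hz⟩ := mulVec_surjective_iff_isUnit.2 hU x
  refine not_isTP_of_mulVec_eq_single (z := z) ?_ ?_ hTP
  · rw [Matrix.mul_assoc, ← mulVec_mulVec, hz, hx]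
  · have h1 := congrFun hz (Fin.last n)
    rw [← mulVec_mulVec, mulVec_diagonal, hx' _ (by simp; omega)] at h1
    have h2 := (mul_eq_zero.1 h1).resolve_left (hd _).ne'
    rw [mulVec, dotProduct, Finset.sum_eq_single (Fin.last n)] at h2
    · rwa [transpose_apply, hV.col_last rfl, one_apply_eq, one_mul] at h2
    · intro b _ hb
      rw [transpose_apply, hV.col_last rfl, one_apply_ne hb, zero_mul]
    · simp

/-! ### The exponents of the words and of the matrices. -/

/-- `r` is the least number of repetitions of `w` with which a product `L * diagonal d * Vᵀ` can be
totally positive, and from `r` on the repetitions of `w` sweep. -/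
def HasWordExponent (n : ℕ) (w : List ℕ) (r : ℕ) : Prop :=
  (∀ m, r ≤ m → Sweeps n (wordPow w m)) ∧
    ∀ (m : ℕ) (L V : Matrix (Fin n) (Fin n) ℝ) (w' : List ℕ) (d : Fin n → ℝ), 1 ≤ m →
      (∀ k, 0 < d k) → HasWord n (wordPow w m) L → HasWord n w' V →
      IsTP (L * diagonal d * Vᵀ) → r ≤ m

theorem mu_one_le_iff {n s m : ℕ} (hn : 2 ≤ n) (hs : 2 ≤ s) :
    mu n .one s ≤ m ↔ n - 1 ≤ m * (s - 1) := by
  have hs' : (0 : ℚ) < (s : ℚ) - 1 := by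
    have : (2 : ℚ) ≤ s := by exact_mod_cast hs
    linarith
  rw [mu, Nat.ceil_le, div_le_iff₀ hs', ← @Nat.cast_le ℚ, Nat.cast_mul, Nat.cast_sub (by omega),
    Nat.cast_sub (by omega), Nat.cast_one]

theorem mu_mem_Icc {n : ℕ} (hn : 2 ≤ n) (i : ClassIndex) {s : ℕ} (hs : s ∈ Set.Icc 2 n) :
    mu n i s ∈ Set.Icc 1 (n - 1) := by
  obtain ⟨h2, hsn⟩ := hs
  cases i with
  | one =>
    refine ⟨?_, ?_⟩
    · by_contra! h
      have := (mu_one_le_iff (m := 0) hn h2).1 (by omega)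
      omega
    · rw [mu_one_le_iff hn h2]
      exact Nat.le_mul_of_pos_right _ (by omega)
  | two => simp only [mu, Set.mem_Icc]; omega

theorem hasWordExponent_wordOne {n s : ℕ} (hn : 2 ≤ n) (hs : 2 ≤ s) :
    HasWordExponent n (wordOne n s) (mu n .one s) := by
  refine ⟨fun m hm => sweeps_wordPow_wordOne (by omega) ((mu_one_le_iff hn hs).1 hm), ?_⟩
  intro m L V w' d _ hd hL hV hTP
  rw [mu_one_le_iff hn hs]
  exact le_of_isTP_wordOne hd hL hV hTP

theorem hasWord_wordOne {n s : ℕ} {l : ℕ → ℕ → ℝ}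
    (h : ∀ i j, 2 ≤ i → i ≤ s → i ≤ j → j ≤ n → 0 < l i j) :
    HasWord n (wordOne n s) (Wprod n 2 s l) :=
  hasWord_Wprod (by omega) h

/-- Zero multipliers are deleted from the word. The positive one leaves the letter `s - 1` needed
for sweeping; the vanishing product gives the missing letter `j` needed for the lower bound. -/
theorem exists_word_of_mem_Psi {n s : ℕ} (hs : 3 ≤ s) (hsn : s ≤ n)
    {P : Matrix (Fin n) (Fin n) ℝ} (hP : P ∈ Psi n (s - 1)) :
    ∃ u, HasWord n u P ∧ s - 1 ∈ u ∧ (∀ i ∈ u, s - 1 ≤ i) ∧ ∃ j, s ≤ j ∧ j ≤ n ∧ j ∉ u := by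
  obtain ⟨v, h0, h1, h2, rfl⟩ := hP
  refine ⟨(descWord n (s - 1)).filter fun i => 0 < v i, ?_, ?_, ?_, ?_⟩
  · rw [W_eq]
    refine hasWord_prod_filter n v _ fun i hi => ?_
    rw [mem_descWord (by omega)] at hi
    exact h0 i hi.1 hi.2
  · rw [List.mem_filter, mem_descWord (by omega)]
    exact ⟨⟨le_rfl, by omega⟩, by simpa using h1⟩
  · intro i hi
    rw [List.mem_filter, mem_descWord (by omega)] at hi
    exact hi.1.1
  · obtain ⟨j, hj, hj0⟩ := Finset.prod_eq_zero_iff.1 h2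
    rw [Finset.mem_Icc] at hj
    refine ⟨j, by omega, hj.2, ?_⟩
    simp [hj0]

theorem exists_word_of_mem_Z {n s : ℕ} (hn : 2 ≤ n) (hs : s ∈ Set.Icc 2 n) {i : ClassIndex}
    {M : Matrix (Fin n) (Fin n) ℝ} (hM : M ∈ Z n i s) :
    ∃ w, HasWord n w M ∧ HasWordExponent n w (mu n i s) := by
  obtain ⟨h2, hsn⟩ := hs
  cases i with
  | one =>
    obtain ⟨l, hl, rfl⟩ := hM
    exact ⟨_, hasWord_wordOne hl, hasWordExponent_wordOne hn h2⟩
  | two =>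
    obtain ⟨l, hl, ⟨rfl, rfl⟩ | ⟨hs, v, hv, P, hP, rfl⟩⟩ := hM
    -- For `s = 2` the full staircase sweeps in a single copy, and the lower bound `1 ≤ m` is part
    -- of the setting.
    · refine ⟨_, hasWord_wordOne hl, fun m hm => ?_, fun m _ _ _ _ hm _ _ _ _ => hm⟩
      exact sweeps_wordPow_wordOne (by omega) (Nat.le_mul_of_pos_left _ hm)
    · obtain ⟨u, hu, hmem, hge, j, hj, hjn, hju⟩ := exists_word_of_mem_Psi hs hsn hP
      refine ⟨wordTwo n s u, ?_, fun m hm => sweeps_wordPow_wordTwo hs hsn hmem hm, ?_⟩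
      · have h1 := hasWord_Lprod (n := n) hv
        rw [show s - 2 + 1 - 2 = s - 3 by omega] at h1
        exact (h1.append hu).append (hasWord_Wprod (by omega) hl)
      · intro m L V w' d hm _ hL hV hTP
        exact le_of_isTP_wordTwo hs hge hj hjn hju hm hL hV hTP

theorem isTP_pow_iff {n : ℕ} (hn : 2 ≤ n) {A : Matrix (Fin n) (Fin n) ℝ} {i j : ClassIndex}
    {s t : ℕ} (h : IsZFactorizable A i s j t) {m : ℕ} (hm : 1 ≤ m) :
    IsTP (A ^ m) ↔ max (mu n i s) (mu n j t) ≤ m := by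
  obtain ⟨hs, ht, L, U, d, hL, hd, hU, rfl⟩ := h
  obtain ⟨w, hw, hw1, hw2⟩ := exists_word_of_mem_Z hn hs hL
  obtain ⟨w', hw', hw1', hw2'⟩ := exists_word_of_mem_Z hn ht hU
  obtain ⟨L', V', e, hL', hV', he, h⟩ := exists_pow_factorization hw hw' hd m
  rw [transpose_transpose] at h
  rw [h, max_le_iff]
  refine ⟨fun hTP => ⟨hw2 m L' V' _ e hm he hL' hV' hTP, hw2' m V' L' _ e hm he hV' hL' ?_⟩,
    fun hmu => isTP_of_sweeps (hw1 m hmu.1) (hw1' m hmu.2) hL' hV' he⟩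
  -- Transposition exchanges the roles of the two words, giving the bound for the upper factor.
  have := hTP.transpose
  simpa [Matrix.transpose_mul, Matrix.mul_assoc] using this

theorem one_le_max_mu {n : ℕ} (hn : 2 ≤ n) {i j : ClassIndex} {s t : ℕ} (hs : s ∈ Set.Icc 2 n) :
    1 ≤ max (mu n i s) (mu n j t) :=
  (mu_mem_Icc hn i hs).1.trans (le_max_left _ _)

theorem IsZFactorizable.isOscillatory {n : ℕ} (hn : 2 ≤ n) {A : Matrix (Fin n) (Fin n) ℝ}
    {i j : ClassIndex} {s t : ℕ} (h : IsZFactorizable A i s j t) : IsOscillatory A := by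
  have hmax := one_le_max_mu (i := i) (j := j) (t := t) hn h.1
  refine ⟨?_, _, hmax, (isTP_pow_iff hn h hmax).2 le_rfl⟩
  obtain ⟨hs, ht, L, U, d, hL, hd, hU, rfl⟩ := h
  obtain ⟨w, hw, -⟩ := exists_word_of_mem_Z hn hs hL
  obtain ⟨w', hw', -⟩ := exists_word_of_mem_Z hn ht hU
  rw [Matrix.mul_assoc]
  refine hw.isTN_mul (IsTN.diagonal_mul hd ?_)
  simpa using hw'.isTN.transpose

theorem exponent_eq_max_mu {n : ℕ} (hn : 2 ≤ n) {A : Matrix (Fin n) (Fin n) ℝ}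
    {i j : ClassIndex} {s t : ℕ} (h : IsZFactorizable A i s j t) :
    exponent A = max (mu n i s) (mu n j t) := by
  have hmax := one_le_max_mu (i := i) (j := j) (t := t) hn h.1
  refine IsLeast.csInf_eq ⟨⟨hmax, (isTP_pow_iff hn h hmax).2 le_rfl⟩, ?_⟩
  rintro m ⟨hm, hTP⟩
  exact (isTP_pow_iff hn h hm).1 hTP

/-- For `s ≥ 3` the factor in `Ψ_{s-1}` is taken with only its first multiplier nonzero; since `s ≤
n`, a later multiplier exists and is zero. -/
theorem Z2_nonempty {n s : ℕ} (hs : s ∈ Set.Icc 2 n) : (Z2 n s).Nonempty := by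
  obtain ⟨h2, hsn⟩ := hs
  rcases h2.eq_or_lt with rfl | h3
  · exact ⟨_, fun _ _ => 1, fun _ _ _ _ _ _ => one_pos, .inl ⟨rfl, rfl⟩⟩
  · refine ⟨_, fun _ _ => 1, fun _ _ _ _ _ _ => one_pos, .inr ⟨h3, fun _ => 1,
      fun _ _ _ => one_pos, W n (s - 1) (Pi.single (s - 1) 1),
      ⟨Pi.single (s - 1) 1, fun j _ _ => ?_, ?_, ?_, rfl⟩, rfl⟩⟩
    · rw [Pi.single_apply]; split_ifs <;> simp
    · simp
    · refine Finset.prod_eq_zero (i := n) (Finset.mem_Icc.2 ⟨by omega, le_rfl⟩) ?_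
      rw [Pi.single_eq_of_ne (by omega)]

theorem exists_isZFactorizable_two {n s : ℕ} (hs : s ∈ Set.Icc 2 n) :
    ∃ A : Matrix (Fin n) (Fin n) ℝ, IsZFactorizable A .two s .two s := by
  obtain ⟨M, hM⟩ := Z2_nonempty hs
  exact ⟨_, hs, hs, M, Mᵀ, 1, hM, fun _ => one_pos, by rwa [transpose_transpose], rfl⟩

end OscExp

theorem corollary1 (n : ℕ) (hn : 2 ≤ n) :
    (∀ (A : Matrix (Fin n) (Fin n) ℝ) (i j : OscExp.ClassIndex) (s t : ℕ),
      OscExp.IsOscillatory A → OscExp.IsZFactorizable A i s j t →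
        OscExp.exponent A = max (OscExp.mu n i s) (OscExp.mu n j t)) ∧
    {r : ℕ | ∃ (i j : OscExp.ClassIndex) (s t : ℕ), s ∈ Set.Icc 2 n ∧ t ∈ Set.Icc 2 n ∧
      r = max (OscExp.mu n i s) (OscExp.mu n j t)} = Set.Icc 1 (n - 1) ∧
    {r : ℕ | ∃ (A : Matrix (Fin n) (Fin n) ℝ) (i j : OscExp.ClassIndex) (s t : ℕ),
      OscExp.IsOscillatory A ∧ OscExp.IsZFactorizable A i s j t ∧
        r = OscExp.exponent A} = Set.Icc 1 (n - 1) := by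
  have hmax : ∀ (i j : OscExp.ClassIndex) (s t : ℕ), s ∈ Set.Icc 2 n → t ∈ Set.Icc 2 n →
      max (OscExp.mu n i s) (OscExp.mu n j t) ∈ Set.Icc 1 (n - 1) := fun i j s t hs ht =>
    ⟨OscExp.one_le_max_mu hn hs,
      max_le (OscExp.mu_mem_Icc hn i hs).2 (OscExp.mu_mem_Icc hn j ht).2⟩
  have hmu : ∀ r, OscExp.mu n .two (r + 1) = r := fun r => Nat.add_sub_cancel r 1
  refine ⟨fun A i j s t _ h => OscExp.exponent_eq_max_mu hn h, ?_, ?_⟩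
  · ext r
    constructor
    · rintro ⟨i, j, s, t, hs, ht, rfl⟩
      exact hmax i j s t hs ht
    · rintro ⟨h1, h2⟩
      have hr : r + 1 ∈ Set.Icc 2 n := ⟨by omega, by omega⟩
      -- Since `μ_2(r + 1) = r`, the second family alone gives all values.
      exact ⟨.two, .two, r + 1, r + 1, hr, hr, by rw [hmu, max_self]⟩
  · ext r
    constructor
    · rintro ⟨A, i, j, s, t, -, h, rfl⟩
      rw [OscExp.exponent_eq_max_mu hn h]
      exact hmax i j s t h.1 h.2.1
    · rintro ⟨h1, h2⟩
      obtain ⟨A, hA⟩ := OscExp.exists_isZFactorizable_two (n := n) (s := r + 1)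
        ⟨by omega, by omega⟩
      refine ⟨A, .two, .two, r + 1, r + 1, hA.isOscillatory hn, hA, ?_⟩
      rw [OscExp.exponent_eq_max_mu hn hA, hmu, max_self]
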